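/- Let $R$ be a commutative Noetherian ring and let $\Phi$ be a system of ideals of $R$, that is, a non-empty set of ideals of $R$ such that for all $\mathfrak a_1,\mathfrak a_2\in\Phi$ there is $\mathfrak b\in\Phi$ with $\mathfrak b\subseteq\mathfrak a_1\mathfrak a_2$. For an $R$-module $X$ put $\Gamma_\Phi(X)=\{x\in X : \mathfrak a x=0 \text{ for some } \mathfrak a\in\Phi\}$, let $H^i_\Phi(-)$ denote the $i$-th right derived functor of the functor $\Gamma_\Phi(-)$ on $R$-modules, and call $X$ $\Phi$-torsion if $\Gamma_\Phi(X)=X$. Let $\mathcal S$ be a Serre subcategory of the category of $R$-modules, i.e. a class of $R$-modules containing $0$ and closed under taking submodules, quotients and extensions. Let $M$ be an arbitrary $R$-module, let $N$ be a $\Phi$-torsion $R$-module (not necessarily finitely generated), and let $t\ge 0$ be an integer. If $\operatorname{Ext}^{t-i}_R(N,H^i_\Phi(M))\in\mathcal S$ for all integers $0\le i\le t$, then $\operatorname{Ext}^t_R(N,M)\in\mathcal S$. -/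

import Mathlib

open CategoryTheory

universe u v

/-- A system of ideals of `R`: a non-empty set `Φ` of ideals such that any product `𝔞₁𝔞₂` of two
members contains a member. -/
structure SystemOfIdeals (R : Type u) [CommRing R] where
  /-- The underlying set of ideals. -/
  ideals : Set (Ideal R)
  nonempty : ideals.Nonempty
  exists_le_mul : ∀ 𝔞₁ ∈ ideals, ∀ 𝔞₂ ∈ ideals, ∃ 𝔟 ∈ ideals, 𝔟 ≤ 𝔞₁ * 𝔞₂

namespace SystemOfIdeals

variable {R : Type u} [CommRing R] (Φ : SystemOfIdeals R)

/-- `Γ_Φ(M) = {x ∈ M | 𝔞 x = 0 for some 𝔞 ∈ Φ}`. -/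
def gamma (M : Type v) [AddCommGroup M] [Module R M] : Submodule R M where
  carrier := {x | ∃ 𝔞 ∈ Φ.ideals, ∀ r ∈ 𝔞, r • x = 0}
  zero_mem' := by
    obtain ⟨𝔞, h⟩ := Φ.nonempty
    exact ⟨𝔞, h, fun r _ => smul_zero r⟩
  add_mem' := by
    rintro x y ⟨𝔞, h𝔞, hx⟩ ⟨𝔟, h𝔟, hy⟩
    obtain ⟨𝔠, h𝔠, hle⟩ := Φ.exists_le_mul 𝔞 h𝔞 𝔟 h𝔟
    refine ⟨𝔠, h𝔠, fun r hr => ?_⟩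
    have h₁ : r ∈ 𝔞 := (hle.trans Ideal.mul_le_left) hr
    have h₂ : r ∈ 𝔟 := (hle.trans Ideal.mul_le_right) hr
    rw [smul_add, hx r h₁, hy r h₂, add_zero]
  smul_mem' := by
    rintro c x ⟨𝔞, h𝔞, hx⟩
    exact ⟨𝔞, h𝔞, fun r hr => by rw [smul_comm, hx r hr, smul_zero]⟩

theorem map_mem_gamma {M N : Type v} [AddCommGroup M] [Module R M] [AddCommGroup N] [Module R N]
    (f : M →ₗ[R] N) : ∀ x ∈ Φ.gamma M, f x ∈ Φ.gamma N := by
  rintro x ⟨𝔞, h𝔞, hx⟩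
  exact ⟨𝔞, h𝔞, fun r hr => by rw [← map_smul, hx r hr, map_zero]⟩

/-- A module `N` is `Φ`-torsion if `Γ_Φ(N) = N`. -/
def IsTorsion (N : Type v) [AddCommGroup N] [Module R N] : Prop :=
  Φ.gamma N = ⊤

/-- The functor `Γ_Φ(-)` from `R`-modules to `R`-modules; on morphisms it is restriction. -/
def gammaFunctor : ModuleCat.{v} R ⥤ ModuleCat.{v} R where
  obj M := ModuleCat.of R (Φ.gamma M)
  map f := ModuleCat.ofHom (f.hom.restrict (Φ.map_mem_gamma f.hom))

instance : (Φ.gammaFunctor : ModuleCat.{v} R ⥤ ModuleCat.{v} R).Additive where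

/-- The `i`-th general local cohomology functor `H^i_Φ(-)`: the `i`-th right derived functor of
`Γ_Φ(-)`. -/
noncomputable def localCohomology [Small.{v} R] (i : ℕ) : ModuleCat.{v} R ⥤ ModuleCat.{v} R :=
  Φ.gammaFunctor.rightDerived i

end SystemOfIdeals

/-! ### Serre classes of `Ext` modules -/

namespace CategoryTheory

open Abelian Limits

universe w v' u'

section SerreClass

variable {R : Type u} [Ring R] (S : ObjectProperty (ModuleCat.{w} R)) [S.IsSerreClass]
  {A B D : Type w} [AddCommGroup A] [Module R A] [AddCommGroup B] [Module R B]
  [AddCommGroup D] [Module R D]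

/-! Let `K` be an injective resolution of `M` and `J = Γ_Φ(K)`. Over a Noetherian ring `J` consists
of injectives (`baer_gamma`), its cohomology is `H^i_Φ(M)`, and every map from the torsion module
`N` to `K` lands in `J`. Short exact sequences of cycles and boundaries take the place of a spectral
sequence. For `t = s + 1`, dimension shifting along `K` reduces `Ext^t(N, M)` to `Ext^1(N, Z^s(K))`
(`prop_ext_cycles_zero`). This is compared with `Ext^1(N, Z^s(J))` (`prop_ext_one_cycles`), which
the cohomology of `J` controls (`prop_ext_cycles`). -/

lemma ObjectProperty.prop_of_surjective (f : A →ₗ[R] B) (hf : Function.Surjective f)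
    (hA : S (ModuleCat.of R A)) : S (ModuleCat.of R B) := by
  have : Epi (ModuleCat.ofHom f) := (ModuleCat.epi_iff_surjective _).2 hf
  exact S.prop_of_epi (ModuleCat.ofHom f) hA

lemma ObjectProperty.prop_of_injective (f : A →ₗ[R] B) (hf : Function.Injective f)
    (hB : S (ModuleCat.of R B)) : S (ModuleCat.of R A) := by
  have : Mono (ModuleCat.ofHom f) := (ModuleCat.mono_iff_injective _).2 hf
  exact S.prop_of_mono (ModuleCat.ofHom f) hB

/-- A subquotient of a module in a Serre class is in the Serre class. -/
lemma ObjectProperty.prop_of_ker_le_ker (g : A →ₗ[R] D) (f : A →ₗ[R] B)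
    (hf : Function.Surjective f) (hle : LinearMap.ker g ≤ LinearMap.ker f)
    (hD : S (ModuleCat.of R D)) : S (ModuleCat.of R B) := by
  have hq : S (ModuleCat.of R (A ⧸ LinearMap.ker g)) :=
    S.prop_of_injective ((LinearMap.ker g).liftQ g le_rfl)
      (LinearMap.ker_eq_bot.1 (Submodule.ker_liftQ_eq_bot _ _ _ le_rfl)) hD
  refine S.prop_of_surjective ((LinearMap.ker g).liftQ f hle) (fun b => ?_) hq
  obtain ⟨a, rfl⟩ := hf b
  exact ⟨Submodule.Quotient.mk a, rfl⟩

lemma ObjectProperty.prop_of_function_exact (f : A →ₗ[R] B) (g : B →ₗ[R] D)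
    (h : Function.Exact f g) (hA : S (ModuleCat.of R A)) (hD : S (ModuleCat.of R D)) :
    S (ModuleCat.of R B) := by
  let T : ShortComplex (ModuleCat.{w} R) := ShortComplex.mk (ModuleCat.ofHom f)
    (ModuleCat.ofHom g) (by ext x; exact h.apply_apply_eq_zero x)
  have hT : T.Exact := (ShortComplex.ShortExact.moduleCat_exact_iff_function_exact T).2 h
  exact S.prop_X₂_of_exact hT hA hD

end SerreClass

section ExtSerreClass

variable {R : Type u} [CommRing R] (S : ObjectProperty (ModuleCat.{w} R)) [S.IsSerreClass]
  {C : Type u'} [Category.{v'} C] [Abelian C] [Linear R C] [HasExt.{w} C] (N : C)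

lemma prop_ext_of_iso {X Y : C} (e : X ≅ Y) {n : ℕ}
    (h : S (ModuleCat.of R (Ext.{w} N X n))) : S (ModuleCat.of R (Ext.{w} N Y n)) := by
  refine S.prop_of_surjective ((Ext.mk₀ e.hom).postcompOfLinear R N (add_zero n))
    (fun y => ⟨y.comp (Ext.mk₀ e.inv) (add_zero n), ?_⟩) h
  simp

variable {T : ShortComplex C} (hT : T.ShortExact)
include hT

lemma ShortComplex.ShortExact.prop_ext_X₂ {n : ℕ}
    (h₁ : S (ModuleCat.of R (Ext.{w} N T.X₁ n))) (h₃ : S (ModuleCat.of R (Ext.{w} N T.X₃ n))) :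
    S (ModuleCat.of R (Ext.{w} N T.X₂ n)) := by
  refine S.prop_of_function_exact ((Ext.mk₀ T.f).postcompOfLinear R N (add_zero n))
    ((Ext.mk₀ T.g).postcompOfLinear R N (add_zero n)) (fun x => ⟨fun hx => ?_, ?_⟩) h₁ h₃
  · exact Ext.covariant_sequence_exact₂ N hT x hx
  · rintro ⟨y, rfl⟩
    simp

lemma ShortComplex.ShortExact.prop_ext_X₁_of_injective [Injective T.X₂] {n : ℕ}
    (h : S (ModuleCat.of R (Ext.{w} N T.X₃ n))) :
    S (ModuleCat.of R (Ext.{w} N T.X₁ (n + 1))) :=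
  S.prop_of_surjective (hT.extClass.postcompOfLinear R N rfl)
    (fun x => Ext.covariant_sequence_exact₁ N hT x (Ext.eq_zero_of_injective _) rfl) h

lemma ShortComplex.ShortExact.prop_ext_X₃_of_injective [Injective T.X₂] {n : ℕ}
    (h : S (ModuleCat.of R (Ext.{w} N T.X₁ (n + 2)))) :
    S (ModuleCat.of R (Ext.{w} N T.X₃ (n + 1))) := by
  refine S.prop_of_injective (hT.extClass.postcompOfLinear R N rfl)
    ((injective_iff_map_eq_zero _).2 fun x hx => ?_) h
  obtain ⟨y, rfl⟩ := Ext.covariant_sequence_exact₃ N hT x rfl hx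
  rw [Ext.eq_zero_of_injective y, Ext.zero_comp]

end ExtSerreClass

end CategoryTheory

/-! ### Cycles and boundaries of cochain complexes -/

namespace CochainComplex

open CategoryTheory Abelian Limits

universe w v' u'

variable {C : Type u'} [Category.{v'} C] [Abelian C] (K : CochainComplex C ℕ)

/-- The boundaries of a cochain complex, as the kernel of the projection of cycles to
cohomology. -/
noncomputable def boundaries (n : ℕ) : C := kernel (K.homologyπ n)

/-- The inclusion of boundaries into cycles. -/
noncomputable def boundariesι (n : ℕ) : K.boundaries n ⟶ K.cycles n := kernel.ι (K.homologyπ n)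

/-- The differential, as a morphism to the boundaries. -/
noncomputable def toBoundaries (n : ℕ) : K.X n ⟶ K.boundaries (n + 1) :=
  kernel.lift _ (K.toCycles n (n + 1)) (K.toCycles_comp_homologyπ n (n + 1))

@[simp]
lemma toBoundaries_boundariesι (n : ℕ) :
    K.toBoundaries n ≫ K.boundariesι (n + 1) = K.toCycles n (n + 1) :=
  kernel.lift_ι _ _ _

instance (n : ℕ) : Mono (K.boundariesι n) := inferInstanceAs (Mono (kernel.ι _))

lemma shortExact_boundaries_cycles_homology (n : ℕ) :
    (ShortComplex.mk (K.boundariesι n) (K.homologyπ n) (kernel.condition _)).ShortExact where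
  exact := ShortComplex.exact_kernel _
  mono_f := inferInstanceAs (Mono (K.boundariesι n))
  epi_g := inferInstanceAs (Epi (K.homologyπ n))

instance (n : ℕ) : Epi (K.toBoundaries n) := by
  have h : (ShortComplex.mk _ _ (K.toCycles_comp_homologyπ n (n + 1))).Exact :=
    ShortComplex.exact_of_g_is_cokernel _ (K.homologyIsCokernel n (n + 1) (by simp))
  exact h.epi_kernelLift

lemma iCycles_toCycles (n : ℕ) : K.iCycles n ≫ K.toCycles n (n + 1) = 0 := by
  simp [← cancel_mono (K.iCycles (n + 1))]

lemma iCycles_toBoundaries (n : ℕ) : K.iCycles n ≫ K.toBoundaries n = 0 := by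
  simp [← cancel_mono (K.boundariesι (n + 1)), Category.assoc, iCycles_toCycles]

/-- A monomorphism `i` does not change the kernel. The target `Y` serves for both boundaries and
cycles. -/
lemma exact_iCycles_of_comp_mono (n : ℕ) {Y : C} (g : K.X n ⟶ Y) (i : Y ⟶ K.X (n + 1)) [Mono i]
    (hg : g ≫ i = K.d n (n + 1)) (zero : K.iCycles n ≫ g = 0) :
    (ShortComplex.mk (K.iCycles n) g zero).Exact := by
  refine ShortComplex.exact_of_f_is_kernel _ (KernelFork.IsLimit.ofι' _ _ fun k hk => ?_)
  have hk' : k ≫ K.d n (n + 1) = 0 := by rw [← hg, ← Category.assoc, hk, zero_comp]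
  exact ⟨K.liftCycles k (n + 1) (by simp) hk', by simp⟩

lemma shortExact_cycles_boundaries (n : ℕ) :
    (ShortComplex.mk (K.iCycles n) (K.toBoundaries n) (K.iCycles_toBoundaries n)).ShortExact where
  exact := K.exact_iCycles_of_comp_mono n _ (K.boundariesι (n + 1) ≫ K.iCycles (n + 1))
    (by simp [← Category.assoc]) _
  mono_f := inferInstanceAs (Mono (K.iCycles n))
  epi_g := inferInstanceAs (Epi (K.toBoundaries n))

lemma shortExact_cycles_cycles (n : ℕ) (h : K.ExactAt (n + 1)) :
    (ShortComplex.mk (K.iCycles n) (K.toCycles n (n + 1)) (K.iCycles_toCycles n)).ShortExact where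
  exact := K.exact_iCycles_of_comp_mono n _ (K.iCycles (n + 1)) (by simp) _
  mono_f := inferInstanceAs (Mono (K.iCycles n))
  epi_g := by
    have hπ : K.homologyπ (n + 1) = 0 :=
      ((K.exactAt_iff_isZero_homology (n + 1)).1 h).eq_of_tgt _ _
    have : Epi (K.boundariesι (n + 1)) :=
      (K.shortExact_boundaries_cycles_homology (n + 1)).exact.epi_f hπ
    have := epi_comp (K.toBoundaries n) (K.boundariesι (n + 1))
    rwa [toBoundaries_boundariesι] at this

/-- Since `f` is mono in each degree, a lift of a cocycle is again a cocycle. -/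
lemma exists_lift_cycles {K J : CochainComplex C ℕ} {N : C} (f : J ⟶ K) [∀ n, Mono (f.f n)]
    (hf : ∀ n (g : N ⟶ K.X n), ∃ g', g' ≫ f.f n = g) (n : ℕ) (g : N ⟶ K.cycles n) :
    ∃ g', g' ≫ HomologicalComplex.cyclesMap f n = g := by
  obtain ⟨g', hg'⟩ := hf n (g ≫ K.iCycles n)
  have h0 : g' ≫ J.d n (n + 1) = 0 := by
    rw [← cancel_mono (f.f (n + 1)), Category.assoc, ← f.comm, ← Category.assoc, hg']
    simp
  exact ⟨J.liftCycles g' (n + 1) (by simp) h0, by simp [← cancel_mono (K.iCycles n), hg']⟩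

section SerreClass

variable {R : Type u} [CommRing R] (S : ObjectProperty (ModuleCat.{w} R)) [S.IsSerreClass]
  [Linear R C] [HasExt.{w} C] (N : C)

/-- For a complex of injectives, `Ext N Z^m (k + 1)` is controlled by the modules
`Ext N H^i (k + 1 + m - i)` with `i ≤ m`. -/
lemma prop_ext_cycles [∀ n, Injective (K.X n)] (m k : ℕ)
    (h : ∀ i n, i ≤ m → i + n = m + (k + 1) → S (ModuleCat.of R (Ext.{w} N (K.homology i) n))) :
    S (ModuleCat.of R (Ext.{w} N (K.cycles m) (k + 1))) := by
  induction m generalizing k with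
  | zero => exact prop_ext_of_iso S N (asIso (K.homologyπ 0)).symm (h 0 (k + 1) le_rfl (by lia))
  | succ m ih =>
    refine (K.shortExact_boundaries_cycles_homology (m + 1)).prop_ext_X₂ S N ?_
      (h (m + 1) (k + 1) le_rfl rfl)
    have : Injective (ShortComplex.mk _ _ (K.iCycles_toBoundaries m)).X₂ :=
      inferInstanceAs (Injective (K.X m))
    -- `Ext^(k+1)` of the boundaries embeds in `Ext^(k+2)` of `Z^m`. This needs positive degree:
    -- `Hom` into an injective need not vanish.
    exact (K.shortExact_cycles_boundaries m).prop_ext_X₃_of_injective S N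
      (ih (k + 1) fun i n hi hn => h i n (by lia) (by lia))

/-- Dimension shifting along a complex of injectives that is exact in positive degrees. -/
lemma prop_ext_cycles_zero [∀ n, Injective (K.X n)] (hK : ∀ n, K.ExactAt (n + 1)) (m k : ℕ)
    (h : S (ModuleCat.of R (Ext.{w} N (K.cycles m) k))) :
    S (ModuleCat.of R (Ext.{w} N (K.cycles 0) (m + k))) := by
  induction m generalizing k with
  | zero => rwa [zero_add]
  | succ m ih =>
    have : Injective (ShortComplex.mk _ _ (K.iCycles_toCycles m)).X₂ :=
      inferInstanceAs (Injective (K.X m))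
    rw [add_right_comm, add_assoc]
    exact ih (k + 1) ((K.shortExact_cycles_cycles m (hK m)).prop_ext_X₁_of_injective S N h)

variable {K} {J : CochainComplex C ℕ} (f : J ⟶ K) [∀ n, Mono (f.f n)]
  (hf : ∀ n (g : N ⟶ K.X n), ∃ g', g' ≫ f.f n = g)

include hf

lemma surjective_ext_cycles (n : ℕ) (x : Ext.{w} N (K.cycles n) 0) :
    ∃ y : Ext.{w} N (J.cycles n) 0,
      y.comp (Ext.mk₀ (HomologicalComplex.cyclesMap f n)) (add_zero 0) = x := by
  obtain ⟨g, rfl⟩ := Ext.homEquiv₀.symm.surjective x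
  obtain ⟨g', rfl⟩ := exists_lift_cycles f hf n g
  exact ⟨Ext.mk₀ g', by simp⟩

/-- The cokernel of `Ext^1(N, Z^n(J)) → Ext^1(N, Z^n(K))` is a quotient of `Hom(N, Z^(n+1)(J))`,
through lifting and the connecting map. Maps into boundaries of `J` die in it, so it is a
subquotient of `Hom(N, H^(n+1)(J))`. -/
lemma prop_ext_one_cycles [∀ n, Injective (K.X n)] (n : ℕ) (hK : K.ExactAt (n + 1))
    (h₁ : S (ModuleCat.of R (Ext.{w} N (J.cycles n) 1)))
    (h₀ : S (ModuleCat.of R (Ext.{w} N (J.homology (n + 1)) 0))) :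
    S (ModuleCat.of R (Ext.{w} N (K.cycles n) 1)) := by
  have hT := K.shortExact_cycles_cycles n hK
  let a := (Ext.mk₀ (HomologicalComplex.cyclesMap f n)).postcompOfLinear R N (add_zero 1)
  let b := (Ext.mk₀ (HomologicalComplex.cyclesMap f (n + 1))).postcompOfLinear R N (add_zero 0)
  let δ := hT.extClass.postcompOfLinear R N (zero_add 1)
  have hδ : Function.Surjective δ := fun x =>
    have : Injective (ShortComplex.mk _ _ (K.iCycles_toCycles n)).X₂ :=
      inferInstanceAs (Injective (K.X n))
    Ext.covariant_sequence_exact₁ N hT x (Ext.eq_zero_of_injective _) rfl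
  refine S.prop_of_function_exact a (LinearMap.range a).mkQ
    (LinearMap.exact_iff.2 (Submodule.ker_mkQ _)) h₁ ?_
  refine S.prop_of_ker_le_ker ((Ext.mk₀ (J.homologyπ (n + 1))).postcompOfLinear R N (add_zero 0))
    ((LinearMap.range a).mkQ ∘ₗ δ ∘ₗ b)
    ((Submodule.mkQ_surjective _).comp (hδ.comp (surjective_ext_cycles N f hf (n + 1))))
    (fun x hx => ?_) h₀
  obtain ⟨y, rfl⟩ := Ext.covariant_sequence_exact₂ N
    (J.shortExact_boundaries_cycles_homology (n + 1)) x hx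
  rw [LinearMap.mem_ker, LinearMap.comp_apply, Submodule.mkQ_apply,
    Submodule.Quotient.mk_eq_zero]
  -- By naturality of the extension class along `φ`, the connecting image of a map into boundaries
  -- of `J` comes from `Ext^1(N, Z^n(J))`.
  let φ : ShortComplex.mk _ _ (J.iCycles_toBoundaries n) ⟶
      ShortComplex.mk _ _ (K.iCycles_toCycles n) :=
    { τ₁ := HomologicalComplex.cyclesMap f n
      τ₂ := f.f n
      τ₃ := J.boundariesι (n + 1) ≫ HomologicalComplex.cyclesMap f (n + 1)
      comm₁₂ := by simp
      comm₂₃ := by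
        change f.f n ≫ K.toCycles n (n + 1) = J.toBoundaries n ≫ J.boundariesι (n + 1) ≫ _
        rw [← Category.assoc, toBoundaries_boundariesι]
        simp [← cancel_mono (K.iCycles (n + 1))] }
  have hφ := (J.shortExact_cycles_boundaries n).extClass_naturality hT φ
  refine ⟨y.comp (J.shortExact_cycles_boundaries n).extClass (zero_add 1), ?_⟩
  change (y.comp (J.shortExact_cycles_boundaries n).extClass (zero_add 1)).comp (Ext.mk₀ φ.τ₁)
      (add_zero 1) =
    ((y.comp (Ext.mk₀ (J.boundariesι (n + 1))) (add_zero 0)).comp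
      (Ext.mk₀ (HomologicalComplex.cyclesMap f (n + 1))) (add_zero 0)).comp hT.extClass (zero_add 1)
  rw [Ext.comp_assoc_of_third_deg_zero, hφ, Ext.comp_assoc_of_second_deg_zero,
    Ext.comp_assoc_of_second_deg_zero, Ext.mk₀_comp_mk₀_assoc]

/-- Let `f : J ⟶ K` be a monomorphism between complexes of injectives through which every morphism
from `N` to a term of `K` factors. If `K` is exact in positive degrees, then `Ext N Z⁰(K) t` is
controlled by the modules `Ext N H^i(J) (t - i)` with `i ≤ t`. -/
lemma prop_ext_of_lift [∀ n, Injective (K.X n)] [∀ n, Injective (J.X n)]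
    (hK : ∀ n, K.ExactAt (n + 1)) (t : ℕ)
    (h : ∀ i n, i + n = t → S (ModuleCat.of R (Ext.{w} N (J.homology i) n))) :
    S (ModuleCat.of R (Ext.{w} N (K.cycles 0) t)) := by
  cases t with
  | zero =>
    exact S.prop_of_surjective
      ((Ext.mk₀ (HomologicalComplex.cyclesMap f 0)).postcompOfLinear R N (add_zero 0))
      (surjective_ext_cycles N f hf 0)
      (prop_ext_of_iso S N (asIso (J.homologyπ 0)).symm (h 0 0 rfl))
  | succ s =>
    exact K.prop_ext_cycles_zero S N hK s 1 (prop_ext_one_cycles S N f hf s (hK s)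
      (J.prop_ext_cycles S N s 0 fun i n _ hn => h i n hn) (h (s + 1) 0 rfl))

end SerreClass

end CochainComplex

/-! ### Torsion modules, injectives and `Γ_Φ` -/

namespace SystemOfIdeals

variable {R : Type u} [CommRing R] (Φ : SystemOfIdeals R)

lemma exists_le_pow {𝔞 : Ideal R} (h𝔞 : 𝔞 ∈ Φ.ideals) (n : ℕ) : ∃ 𝔟 ∈ Φ.ideals, 𝔟 ≤ 𝔞 ^ n := by
  induction n with
  | zero => exact ⟨𝔞, h𝔞, by simp⟩
  | succ n ih =>
    obtain ⟨𝔟, h𝔟, hle⟩ := ih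
    obtain ⟨𝔠, h𝔠, hle'⟩ := Φ.exists_le_mul 𝔟 h𝔟 𝔞 h𝔞
    exact ⟨𝔠, h𝔠, hle'.trans (by rw [pow_succ]; exact Ideal.mul_mono_left hle)⟩

variable {M : Type v} [AddCommGroup M] [Module R M]

/-- A finitely generated submodule of `Γ_Φ(M)` is killed by a single member of `Φ`. -/
lemma exists_smul_eq_zero_of_fg {P : Submodule R M} (hP : P.FG) (hle : P ≤ Φ.gamma M) :
    ∃ 𝔞 ∈ Φ.ideals, ∀ r ∈ 𝔞, ∀ x ∈ P, r • x = 0 := by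
  induction P, hP using Submodule.fg_induction with
  | singleton x =>
    obtain ⟨𝔞, h𝔞, h⟩ := hle (Submodule.mem_span_singleton_self x)
    refine ⟨𝔞, h𝔞, fun r hr y hy => ?_⟩
    obtain ⟨c, rfl⟩ := Submodule.mem_span_singleton.1 hy
    rw [smul_comm, h r hr, smul_zero]
  | sup P Q hP hQ ihP ihQ =>
    obtain ⟨𝔞, h𝔞, h⟩ := ihP (le_sup_left.trans hle)
    obtain ⟨𝔟, h𝔟, h'⟩ := ihQ (le_sup_right.trans hle)
    obtain ⟨𝔠, h𝔠, hc⟩ := Φ.exists_le_mul 𝔞 h𝔞 𝔟 h𝔟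
    refine ⟨𝔠, h𝔠, fun r hr y hy => ?_⟩
    obtain ⟨p, hp, q, hq, rfl⟩ := Submodule.mem_sup.1 hy
    rw [smul_add, h r (Ideal.mul_le_left (hc hr)) p hp, h' r (Ideal.mul_le_right (hc hr)) q hq,
      add_zero]

/-- Over a Noetherian ring, `Γ_Φ` preserves injective modules. -/
lemma baer_gamma [IsNoetherianRing R] (hM : Module.Baer R M) : Module.Baer R (Φ.gamma M) := by
  intro I g
  obtain ⟨𝔞, h𝔞, hkill⟩ : ∃ 𝔞 ∈ Φ.ideals, ∀ r ∈ 𝔞, ∀ x : I, r • g x = 0 := by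
    let g' : I →ₗ[R] M := (Φ.gamma M).subtype ∘ₗ g
    obtain ⟨𝔞, h𝔞, h⟩ := Φ.exists_smul_eq_zero_of_fg (P := LinearMap.range g')
      (LinearMap.range_eq_map g' ▸ (Module.Finite.fg_top (R := R) (M := I)).map g')
      (by rintro _ ⟨x, rfl⟩; exact (g x).2)
    exact ⟨𝔞, h𝔞, fun r hr x => Subtype.ext (h r hr _ ⟨x, rfl⟩)⟩
  -- Artin–Rees: `𝔞^(k+1) ∩ I = 𝔞(𝔞^k ∩ I) ⊆ 𝔞I`, which `g` kills, so `g` vanishes on `I ∩ 𝔟`.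
  obtain ⟨k, hk⟩ := 𝔞.exists_pow_inf_eq_pow_smul (M := R) I
  obtain ⟨𝔟, h𝔟, hle⟩ := Φ.exists_le_pow h𝔞 (k + 1)
  have hI : ∀ x : I, (x : R) ∈ 𝔟 → g x = 0 := by
    intro x hx
    have hmem : (x : R) ∈ 𝔞 ^ (k + 1) • (⊤ : Submodule R R) ⊓ I :=
      ⟨by simpa using hle hx, x.2⟩
    rw [hk (k + 1) (by lia), Nat.add_sub_cancel_left, pow_one] at hmem
    have hmap : 𝔞 • I ≤ (LinearMap.ker g).map I.subtype :=
      Submodule.smul_le.2 fun r hr y hy =>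
        ⟨r • ⟨y, hy⟩, by simpa only [SetLike.mem_coe, LinearMap.mem_ker, map_smul] using hkill r hr ⟨y, hy⟩,
          rfl⟩
    obtain ⟨y, hy, hyx⟩ := hmap (Submodule.smul_mono le_rfl inf_le_right hmem)
    obtain rfl : y = x := Subtype.ext hyx
    exact hy
  let q : I →ₗ[R] R ⧸ 𝔟 := 𝔟.mkQ ∘ₗ I.subtype
  have hq : LinearMap.ker q ≤ LinearMap.ker ((Φ.gamma M).subtype ∘ₗ g) := fun x hx => by
    have hx' : (x : R) ∈ 𝔟 := (Submodule.Quotient.mk_eq_zero 𝔟).1 hx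
    simp [hI x hx']
  -- Extending from `I/(I ∩ 𝔟)` to `R ⧸ 𝔟`, rather than to `R`, makes the image killed by `𝔟`, hence
  -- contained in `Γ_Φ(M)`.
  obtain ⟨e, he⟩ := hM.extension_property ((LinearMap.ker q).liftQ q le_rfl)
    (LinearMap.ker_eq_bot.1 (Submodule.ker_liftQ_eq_bot _ _ _ le_rfl))
    ((LinearMap.ker q).liftQ _ hq)
  refine ⟨(e ∘ₗ 𝔟.mkQ).codRestrict (Φ.gamma M) fun x => ⟨𝔟, h𝔟, fun r hr => ?_⟩,
    fun x hx => Subtype.ext ?_⟩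
  · rw [← map_smul, LinearMap.comp_apply, Submodule.mkQ_apply, smul_eq_mul,
      (Submodule.Quotient.mk_eq_zero 𝔟).2 (𝔟.mul_mem_right x hr), map_zero]
  · exact LinearMap.congr_fun he (Submodule.Quotient.mk ⟨x, hx⟩)

/-- The inclusion of `Γ_Φ` in the identity functor. -/
def gammaι : (Φ.gammaFunctor : ModuleCat.{v} R ⥤ ModuleCat.{v} R) ⟶ 𝟭 _ where
  app M := ModuleCat.ofHom (Φ.gamma M).subtype

instance (M : ModuleCat.{v} R) : Mono (Φ.gammaι.app M) :=
  (ModuleCat.mono_iff_injective _).2 Subtype.val_injective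

lemma IsTorsion.exists_lift {Φ : SystemOfIdeals R} {N M : ModuleCat.{v} R} (hN : Φ.IsTorsion N)
    (g : N ⟶ M) : ∃ g', g' ≫ Φ.gammaι.app M = g :=
  ⟨ModuleCat.ofHom (g.hom.codRestrict (Φ.gamma M)
    fun x => Φ.map_mem_gamma g.hom x (hN ▸ Submodule.mem_top)), rfl⟩

instance [IsNoetherianRing R] [Small.{v} R] (M : ModuleCat.{v} R) [Injective M] :
    Injective (Φ.gammaFunctor.obj M) := by
  have : Module.Injective R M := Module.injective_module_of_injective_object R M
  have : Module.Injective R (Φ.gamma M) :=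
    (Φ.baer_gamma (Module.Baer.of_injective this)).injective
  exact Module.injective_object_of_injective_module R (Φ.gamma M)

/-- The inclusion of complexes `Γ_Φ(K) ⟶ K`. -/
def gammaComplexι (K : CochainComplex (ModuleCat.{v} R) ℕ) :
    (Φ.gammaFunctor.mapHomologicalComplex _).obj K ⟶ K where
  f n := Φ.gammaι.app (K.X n)
  comm' i j _ := (Φ.gammaι.naturality (K.d i j)).symm

instance (K : CochainComplex (ModuleCat.{v} R) ℕ) (n : ℕ) : Mono ((Φ.gammaComplexι K).f n) :=
  inferInstanceAs (Mono (Φ.gammaι.app (K.X n)))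

end SystemOfIdeals

theorem theorem2p1 {R : Type u} [CommRing R] [IsNoetherianRing R] [Small.{v} R]
    (Φ : SystemOfIdeals R)
    (S : ObjectProperty (ModuleCat.{v} R)) [S.IsSerreClass]
    (M N : ModuleCat.{v} R) (hN : Φ.IsTorsion N) (t : ℕ)
    (h : ∀ i : ℕ, i ≤ t →
      S (ModuleCat.of R (Abelian.Ext.{v} N ((Φ.localCohomology i).obj M) (t - i)))) :
    S (ModuleCat.of R (Abelian.Ext.{v} N M t)) := by
  let I : InjectiveResolution M := injectiveResolution M
  let J := (Φ.gammaFunctor.mapHomologicalComplex (ComplexShape.up ℕ)).obj I.cocomplex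
  have (n : ℕ) : Injective (J.X n) :=
    inferInstanceAs (Injective (Φ.gammaFunctor.obj (I.cocomplex.X n)))
  have e : I.cocomplex.cycles 0 ≅ M :=
    Limits.IsLimit.conePointUniqueUpToIso (I.cocomplex.cyclesIsKernel 0 1 (by simp)) I.isLimitKernelFork
  refine prop_ext_of_iso S N e (CochainComplex.prop_ext_of_lift S N (Φ.gammaComplexι I.cocomplex)
    (fun n g => hN.exists_lift g) I.cocomplex_exactAt_succ t fun i n hn => ?_)
  obtain rfl : n = t - i := by lia
  exact prop_ext_of_iso S N (I.isoRightDerivedObj Φ.gammaFunctor i) (h i (by lia))
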